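/- Let $m,s\ge 1$, let $p\in\mathbb F_2[x]$ be irreducible with $\deg p=m$, let $q=(q_1,\dots,q_s)\in(\mathbb F_2[x])^s$, write $I_s=\{1,\dots,s\}$, and let $\gamma_u\ge 0$ be given for all $u\subseteq I_s$. For points $x_0,\dots,x_{N-1}\in[0,1]^s$ put $$\Delta(t)=\tfrac1N\,\#\{0\le n<N: x_n\in[0,t_1)\times\cdots\times[0,t_s)\}-t_1\cdots t_s,$$ $$\mathcal L_{2,N,\gamma}=\Big(\sum_{\emptyset\ne u\subseteq I_s}\gamma_u\int_{[0,1]^{u}}|\Delta(t_u,1)|^2\,dt_u\Big)^{1/2},$$ where $(t_u,1)$ has the components $t_j$ for $j\in u$ and $1$ for $j\notin u$. The polynomial lattice point set $P_{2^m,s}(q,p)$ consists of the points $$x_n=\Big(v_m\Big(\frac{n(x)q_1(x)}{p(x)}\Big),\dots,v_m\Big(\frac{n(x)q_s(x)}{p(x)}\Big)\Big),\qquad 0\le n<2^m.$$ Here $k(x)=\sum_i\kappa_ix^i\in\mathbb F_2[x]$ for an integer $k=\sum_i\kappa_i2^i\ge0$ with binary digits $\kappa_i$, quotients are taken in $\mathbb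 F_2((x^{-1}))$, and $v_m(\sum_{l\ge w}t_lx^{-l})=\sum_{l=\max(1,w)}^m t_l2^{-l}$. With $\mathrm{tr}_m(k)=\sum_{i=0}^{m-1}\kappa_ix^i$, its dual polynomial lattice is $$D^*_{q,p}=\Big\{k\in\mathbb N_0^s:\ p \text{ divides } \sum_{j=1}^s\mathrm{tr}_m(k_j)\,q_j \text{ in } \mathbb F_2[x]\Big\}.$$ Let $\tilde P_{2^m,s}(q,p)$ be the Owen-scrambled point set. That is, the $k$-th binary digit $x_{j,k}$ of the $j$-th coordinate of each point (in the dyadic expansion without infinitely many consecutive ones) is replaced by $\pi_{j,x_{j,1},\dots,x_{j,k-1}}(x_{j,k})$, where the $\pi_{j,a}$ (for $j\in I_s$ and $a$ a finite, possibly empty, string of binary digits) are mutually independent random permutations of $\{0,1\}$, each uniformly distributed, and the same permutations are used for all points. Then $\mathcal L_{2,2^m,\gamma}^2(\tilde P_{2^m,s}(q,p))$ is integrable and $$\mathbb E\big[\mathcal L_{2,2^m,\gamma}^2(\tilde P_{2^m,s}(q,p))\big]=\sum_{\emptyset\ne v\subseteq I_s}\tilde\gamma_v\sum_{\substack{k_v\in\mathbb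 N^{|v|}\\(k_v,0)\in D^*_{q,p}}}\psi(k_v,0),\qquad \tilde\gamma_v=\sum_{v\subseteq u\subseteq I_s}\frac{\gamma_u}{3^{|u|}},$$ where all the inner sums converge. Here $\mathbb N=\{1,2,\dots\}$, the vector $(k_v,0)\in\mathbb N_0^s$ has the components of $k_v$ at the indices in $v$ and zeros elsewhere, $\psi(k_1,\dots,k_s)=\prod_{j=1}^s\psi(k_j)$, $\psi(0)=1$, and $\psi(k)=4^{-a_1}$ for an integer $k=2^{a_1-1}+\cdots+2^{a_r-1}$ with $a_1>\cdots>a_r>0$. -/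

import Mathlib

open MeasureTheory ProbabilityTheory Polynomial

noncomputable section

namespace PolyLat

/-! ### Weighted `L₂` discrepancy -/

/-- The vector `(t_u, 1)`: components outside `u` are replaced by one. -/
def extendOne {s : ℕ} (u : Finset (Fin s)) (t : u → ℝ) : Fin s → ℝ :=
  fun j => if h : j ∈ u then t ⟨j, h⟩ else 1

/-- The local discrepancy `Δ(t) = A_N([0,t), P) / N - t₁ ⋯ t_s` of the points
`x 0, …, x (N - 1)`; points are counted with multiplicity. -/
def localDiscrepancy {N s : ℕ} (x : Fin N → Fin s → ℝ) (t : Fin s → ℝ) : ℝ :=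
  (Nat.card {n : Fin N // ∀ j, x n j ∈ Set.Ico 0 (t j)} : ℝ) / N - ∏ j, t j

/-- The weighted `L₂` discrepancy with weights `γ`. -/
def weightedL2Discrepancy {N s : ℕ} (γ : Finset (Fin s) → ℝ) (x : Fin N → Fin s → ℝ) : ℝ :=
  Real.sqrt (∑ u : Finset (Fin s) with u.Nonempty,
    γ u * ∫ t in Set.Icc (0 : u → ℝ) 1, |localDiscrepancy x (extendOne u t)| ^ 2)

/-! ### Polynomial lattice point sets -/

/-- The embedding of `𝔽₂[x]` into the field `𝔽₂((x⁻¹))` of formal Laurent series in `x⁻¹`.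
An element of the latter is a Laurent series whose coefficient at `l` belongs to `x^(-l)`,
so that `x` is the series with the single coefficient `1` at `-1`. -/
def toLaurent (f : (ZMod 2)[X]) : LaurentSeries (ZMod 2) :=
  Polynomial.aeval (HahnSeries.single (-1 : ℤ) (1 : ZMod 2) : LaurentSeries (ZMod 2)) f

/-- `v_m (∑ t_l x^(-l)) = ∑_{1 ≤ l ≤ m} t_l 2^(-l)`. -/
def truncEval (m : ℕ) (L : LaurentSeries (ZMod 2)) : ℝ :=
  ∑ l ∈ Finset.Icc 1 m, ((L.coeff (l : ℤ)).val : ℝ) / 2 ^ l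

/-- `tr_m(k) = k₀ + k₁ x + ⋯ + k_{m-1} x^(m-1)`, where `k₀, k₁, …` are the binary digits of `k`. -/
def truncPoly (m k : ℕ) : (ZMod 2)[X] :=
  ∑ i ∈ Finset.range m, if k.testBit i then X ^ i else 0

/-- The polynomial `k(x)` over `𝔽₂` whose coefficients are the binary digits of `k`
(a number `k` has `k.size` binary digits). -/
def natPoly (k : ℕ) : (ZMod 2)[X] := truncPoly k.size k

/-- The polynomial lattice point set `P_{2^m,s}(q,p)`: its `n`-th point has the components
`v_m (n(x) q_j(x) / p(x))`. -/
def polyLatticePoint {s : ℕ} (m : ℕ) (p : (ZMod 2)[X]) (q : Fin s → (ZMod 2)[X]) :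
    Fin (2 ^ m) → Fin s → ℝ :=
  fun n j => truncEval m (toLaurent (natPoly n * q j) / toLaurent p)

/-- The dual polynomial lattice `{k : tr_m(k) · q ≡ 0 (mod p)}`. -/
def dualLattice {s : ℕ} (m : ℕ) (p : (ZMod 2)[X]) (q : Fin s → (ZMod 2)[X]) :
    Set (Fin s → ℕ) :=
  {k | p ∣ ∑ j, truncPoly m (k j) * q j}

/-! ### Owen's scrambling -/

/-- The scrambling of one coordinate: the digit after the prefix `x₁, …, x_k` of the dyadic
expansion of `x` is permuted by `σ [x₁, …, x_k]`. (`Real.digits x 2 i` is the binary digit of `x`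
belonging to `2^(-(i+1))`, in the expansion without infinitely many consecutive ones.) -/
def scramble (σ : List (Fin 2) → Equiv.Perm (Fin 2)) (x : ℝ) : ℝ :=
  Real.ofDigits fun k : ℕ =>
    σ (List.ofFn fun i : Fin k => Real.digits x 2 i) (Real.digits x 2 k)

/-- The scrambled point set; coordinate `j` of every point is scrambled by the same family
`σ j` of permutations. -/
def scramblePoints {N s : ℕ} (σ : Fin s → List (Fin 2) → Equiv.Perm (Fin 2))
    (x : Fin N → Fin s → ℝ) : Fin N → Fin s → ℝ :=
  fun n j => scramble (σ j) (x n j)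

/-- The random permutations used by Owen's scrambling in base two: one for each coordinate and
each finite digit prefix, mutually independent, each uniform on the two permutations of
`{0, 1}`. -/
structure IsOwenScrambling {Ω : Type*} [MeasurableSpace Ω] {s : ℕ} (P : Measure Ω)
    (π : Fin s → List (Fin 2) → Ω → Equiv.Perm (Fin 2)) : Prop where
  measurable : ∀ j a, Measurable[_, ⊤] (π j a)
  indep : iIndepFun (β := fun _ => Equiv.Perm (Fin 2)) (m := fun _ => ⊤)
    (fun i : Fin s × List (Fin 2) => π i.1 i.2) P
  uniform : ∀ j a τ, P {ω | π j a ω = τ} = 1 / 2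

/-! ### The dual lattice sum -/

/-- `γ̃_v = ∑_{v ⊆ u} γ_u / 3^|u|`. -/
def gammaTilde {s : ℕ} (γ : Finset (Fin s) → ℝ) (v : Finset (Fin s)) : ℝ :=
  ∑ u : Finset (Fin s) with v ⊆ u, γ u / 3 ^ u.card

/-- The vector `(k_v, 0)`: components outside `v` are replaced by zero. -/
def extendZero {s : ℕ} (v : Finset (Fin s)) (k : v → ℕ+) : Fin s → ℕ :=
  fun j => if h : j ∈ v then (k ⟨j, h⟩ : ℕ) else 0

/-- `ψ(0) = 1`, and `ψ(k) = 4^(-a₁)` for `k = 2^(a₁-1) + ⋯ + 2^(a_r-1)` with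
`a₁ > ⋯ > a_r > 0`, that is, `a₁ = ⌊log₂ k⌋ + 1`. -/
def psi (k : ℕ) : ℝ := if k = 0 then 1 else 1 / 4 ^ (Nat.log 2 k + 1)

/-- `ψ(k) = ∏_j ψ(k_j)` for vectors. -/
def psiVec {s : ℕ} (k : Fin s → ℕ) : ℝ := ∏ j, psi (k j)

end PolyLat

end

/-!
Warnock's formula expresses `∫ |Δ|²` through the kernel `∏ j, (1 - max (x j) (y j))` at pairs of
points. Since the coordinates are scrambled independently, its expectation is a product over the
coordinates. If the digits of `x` and `y` first differ at place `i`, exactly one of the scrambled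
numbers `X` and `Y` has the digit one there, and it is the larger one, so that
`max X Y = X_i * X + Y_i * Y`. The expectation of this only depends on the digits of each single
number being independent fair bits, and one minus it is a third of `∑ k, ψ(k) wal_k(x) wal_k(y)`.

Multiplying out, the expected squared discrepancy of any scrambled point set is a weighted sum of
`ψ(k)` times the squared mean over the points of the Walsh function `wal_k`. For a polynomial
lattice, `wal_k` at the point with index `n` is `(-1)^c`, where `c` is the coefficient of `x⁻¹` in
`n(x) (∑ j, tr_m(k_j) q_j) / p`. This is an additive character of `n`, so its mean is one if `k` is
in the dual lattice and zero otherwise.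
-/

noncomputable section

namespace PolyLat

/-- The `k`-th Walsh function, as a function of the sequence of binary digits of its argument: the
product of the signs `(-1)^(x i)` over the positions `i` of the ones in the binary expansion
of `k`. -/
def walsh (k : ℕ) (x : ℕ → Fin 2) : ℝ :=
  (k.bitIndices.map fun i => (-1 : ℝ) ^ (x i : ℕ)).prod

lemma walsh_zero (x : ℕ → Fin 2) : walsh 0 x = 1 := by
  simp [walsh]

lemma walsh_two_mul (k : ℕ) (x : ℕ → Fin 2) :
    walsh (2 * k) x = walsh k fun i => x (i + 1) := by
  simp [walsh, Function.comp_def]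

lemma walsh_two_mul_add_one (k : ℕ) (x : ℕ → Fin 2) :
    walsh (2 * k + 1) x = (-1) ^ (x 0 : ℕ) * walsh k fun i => x (i + 1) := by
  simp [walsh, Function.comp_def]

lemma walsh_mul_self (k : ℕ) (x : ℕ → Fin 2) : walsh k x * walsh k x = 1 := by
  simp [walsh, ← List.prod_map_mul, ← mul_pow]

lemma abs_walsh (k : ℕ) (x : ℕ → Fin 2) : |walsh k x| = 1 :=
  (abs_eq zero_le_one).2 (mul_self_eq_one_iff.1 (walsh_mul_self k x))

lemma psi_zero : psi 0 = 1 := by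
  simp [psi]

lemma psi_nonneg (k : ℕ) : 0 ≤ psi k := by
  unfold psi
  split_ifs <;> positivity

lemma psi_two_mul {k : ℕ} (hk : k ≠ 0) : psi (2 * k) = psi k / 4 := by
  have hlog : Nat.log 2 (2 * k) = Nat.log 2 k + 1 := by
    rw [mul_comm, Nat.log_mul_base one_lt_two hk]
  simp only [psi, hk, hlog, mul_eq_zero, OfNat.ofNat_ne_zero, or_self, if_false,
    pow_succ _ (Nat.log 2 k + 1)]
  field_simp

lemma psi_two_mul_add_one (k : ℕ) :
    psi (2 * k + 1) = psi k / 4 := by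
  rcases eq_or_ne k 0 with rfl | hk
  · simp [psi]
  have hlog : Nat.log 2 (2 * k + 1) = Nat.log 2 k + 1 := by
    rw [Nat.log_of_one_lt_of_le one_lt_two (by lia), show (2 * k + 1) / 2 = k by lia]
  simp only [psi, hk, hlog, if_false, Nat.add_eq_zero_iff, one_ne_zero, and_false,
    pow_succ _ (Nat.log 2 k + 1)]
  field_simp

lemma psi_le_inv_sq {k : ℕ} (hk : k ≠ 0) : psi k ≤ 1 / (k : ℝ) ^ 2 := by
  have hlt : k < 2 ^ (Nat.log 2 k + 1) := Nat.lt_pow_succ_log_self one_lt_two k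
  have hsq : k ^ 2 ≤ 4 ^ (Nat.log 2 k + 1) := by
    calc k ^ 2 ≤ (2 ^ (Nat.log 2 k + 1)) ^ 2 := Nat.pow_le_pow_left hlt.le 2
      _ = 4 ^ (Nat.log 2 k + 1) := by rw [← pow_mul, mul_comm, pow_mul]; norm_num
  rw [psi, if_neg hk]
  exact one_div_le_one_div_of_le (by positivity) (by exact_mod_cast hsq)

lemma summable_psi : Summable psi := by
  have hsq := (summable_nat_add_iff 1).2 (Real.summable_one_div_nat_pow.2 one_lt_two)
  exact (summable_nat_add_iff 1).1
    (hsq.of_nonneg_of_le (fun k => psi_nonneg _) fun k => psi_le_inv_sq k.succ_ne_zero)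

/-- The kernel `∑ ψ(k) wal_k(x) wal_k(y)`, a function of two sequences of binary digits. -/
def walshKernel (x y : ℕ → Fin 2) : ℝ :=
  ∑' k, psi k * (walsh k x * walsh k y)

lemma norm_psi_mul_walsh_mul_walsh (k : ℕ) (x y : ℕ → Fin 2) :
    ‖psi k * (walsh k x * walsh k y)‖ = psi k := by
  simp only [norm_mul, Real.norm_eq_abs, abs_walsh, mul_one, abs_of_nonneg (psi_nonneg k)]

lemma hasSum_walshKernel (x y : ℕ → Fin 2) :
    HasSum (fun k => psi k * (walsh k x * walsh k y)) (walshKernel x y) :=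
  (summable_psi.of_norm_bounded fun k => (norm_psi_mul_walsh_mul_walsh k x y).le).hasSum

lemma hasSum_pnat_walshKernel_sub_one (x y : ℕ → Fin 2) :
    HasSum (fun k : ℕ+ => psi k * (walsh k x * walsh k y)) (walshKernel x y - 1) := by
  have h := (hasSum_nat_add_iff' 1).2 (hasSum_walshKernel x y)
  simp only [Finset.range_one, Finset.sum_singleton, psi_zero, walsh_zero, mul_one] at h
  exact (Equiv.pnatEquivNat.symm.hasSum_iff
    (f := fun k : ℕ+ => psi k * (walsh k x * walsh k y))).1 h

lemma walshKernel_eq_shift (x y : ℕ → Fin 2) :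
    walshKernel x y = 1 + (-1) ^ (x 0 + y 0 : ℕ) / 4 + (1 + (-1) ^ (x 0 + y 0 : ℕ)) / 4 *
      (walshKernel (fun i => x (i + 1)) (fun i => y (i + 1)) - 1) := by
  set K := walshKernel (fun i => x (i + 1)) (fun i => y (i + 1))
  have hodd : HasSum (fun k => psi (2 * k + 1) * (walsh (2 * k + 1) x * walsh (2 * k + 1) y))
      ((-1) ^ (x 0 + y 0 : ℕ) / 4 * K) := by
    refine ((hasSum_walshKernel _ _).mul_left _).congr_fun fun k => ?_
    rw [psi_two_mul_add_one, walsh_two_mul_add_one, walsh_two_mul_add_one, pow_add]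
    ring
  have heven : HasSum (fun k => psi (2 * k) * (walsh (2 * k) x * walsh (2 * k) y))
      (K / 4 + 3 / 4) := by
    refine (((hasSum_walshKernel _ _).div_const 4).add
      (hasSum_ite_eq 0 (3 / 4 : ℝ))).congr_fun fun k => ?_
    rw [walsh_two_mul, walsh_two_mul]
    rcases eq_or_ne k 0 with rfl | hk
    · norm_num [psi_zero, walsh_zero]
    · rw [psi_two_mul hk, if_neg hk]
      ring
  rw [walshKernel, (heven.even_add_odd (f := fun k => psi k * (walsh k x * walsh k y))
    hodd).tsum_eq]
  ring

lemma walshKernel_self (x : ℕ → Fin 2) : walshKernel x x = 3 / 2 := by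
  have hdiag (y : ℕ → Fin 2) : walshKernel y y = ∑' k, psi k := by
    simp only [walshKernel, walsh_mul_self, mul_one]
  have hrec := walshKernel_eq_shift x x
  rw [Even.neg_one_pow ⟨_, rfl⟩, hdiag fun i => x (i + 1), ← hdiag x] at hrec
  linarith

lemma walshKernel_of_first_ne {x y : ℕ → Fin 2} {i : ℕ} (hlt : ∀ l < i, x l = y l)
    (hne : x i ≠ y i) : walshKernel x y = 3 * (1 / 2 - (1 / 2) ^ (i + 2)) := by
  induction i generalizing x y with
  | zero =>
    have hodd : Odd (x 0 + y 0 : ℕ) := by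
      revert hne
      generalize x 0 = a
      generalize y 0 = b
      revert a b
      decide
    rw [walshKernel_eq_shift, hodd.neg_one_pow]
    norm_num
  | succ i ih =>
    rw [walshKernel_eq_shift, hlt 0 i.succ_pos, Even.neg_one_pow ⟨_, rfl⟩,
      ih (fun l hl => hlt _ (Nat.succ_lt_succ hl)) hne]
    ring

section ProductsOfSeries

variable {R κ : Type*} [NormedCommRing R] [CompleteSpace R]

lemma hasSum_prod_pi_fin {n : ℕ} {f : Fin n → κ → R} {a : Fin n → R}
    (hf : ∀ i, Summable fun k => ‖f i k‖) (ha : ∀ i, HasSum (f i) (a i)) :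
    (Summable fun k : Fin n → κ => ‖∏ i, f i (k i)‖) ∧
      HasSum (fun k : Fin n → κ => ∏ i, f i (k i)) (∏ i, a i) := by
  induction n with
  | zero => exact ⟨Summable.of_finite, by simp [hasSum_unique]⟩
  | succ n ih =>
    obtain ⟨htail, hsum⟩ := ih (fun i => hf i.succ) fun i => ha i.succ
    let cons : κ × (Fin n → κ) ≃ (Fin (n + 1) → κ) := Fin.consEquiv fun _ => κ
    have hcons (z : κ × (Fin n → κ)) :
        ∏ i, f i (cons z i) = f 0 z.1 * ∏ i : Fin n, f i.succ (z.2 i) := by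
      simp [cons, Fin.consEquiv, Fin.prod_univ_succ]
    constructor
    · rw [← cons.summable_iff]
      simpa only [Function.comp_def, hcons] using Summable.mul_norm (hf 0) htail
    · rw [← cons.hasSum_iff, Fin.prod_univ_succ]
      have hmul := summable_mul_of_summable_norm (hf 0) htail
      simpa only [Function.comp_def, hcons] using (ha 0).mul hsum hmul

lemma hasSum_prod_pi {ι : Type*} [Fintype ι] {f : ι → κ → R} {a : ι → R}
    (hf : ∀ i, Summable fun k => ‖f i k‖) (ha : ∀ i, HasSum (f i) (a i)) :
    HasSum (fun k : ι → κ => ∏ i, f i (k i)) (∏ i, a i) := by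
  let e := (Fintype.equivFin ι).symm
  let reindex : (Fin (Fintype.card ι) → κ) ≃ (ι → κ) := e.arrowCongr (Equiv.refl κ)
  have hfin := (hasSum_prod_pi_fin (fun i => hf (e i)) fun i => ha (e i)).2
  rw [e.prod_comp a] at hfin
  rw [← reindex.hasSum_iff]
  refine hfin.congr_fun fun k => ?_
  simp [reindex, ← e.prod_comp]

end ProductsOfSeries

section Digits

variable {b : ℕ}

lemma ofDigitsTerm_le_ofDigitsTerm {x y : ℕ → Fin b} {k : ℕ} (h : x k ≤ y k) :
    Real.ofDigitsTerm x k ≤ Real.ofDigitsTerm y k := by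
  unfold Real.ofDigitsTerm
  gcongr
  exact h

lemma ofDigits_lt_one {d : ℕ → Fin (b + 1)} {k : ℕ} (hk : d k ≠ Fin.last b) :
    Real.ofDigits d < 1 := by
  have : NeZero b := ⟨by rintro rfl; lia⟩
  rw [← Real.ofDigits_const_last_eq_one b]
  refine Summable.tsum_lt_tsum (i := k) (fun l => ofDigitsTerm_le_ofDigitsTerm (Fin.le_last _)) ?_
    Real.summable_ofDigitsTerm Real.summable_ofDigitsTerm
  have hlt : d k < Fin.last b := Fin.lt_last_iff_ne_last.2 hk
  unfold Real.ofDigitsTerm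
  gcongr
  exact hlt

lemma ofDigits_eq_div (d : ℕ → Fin b) :
    Real.ofDigits d = ((d 0 : ℕ) + Real.ofDigits fun i => d (i + 1)) / b := by
  rw [Real.ofDigits_eq_sum_add_ofDigits d 1]
  simp [Real.ofDigitsTerm]
  ring

lemma digits_ofDigits {d : ℕ → Fin (b + 1)} (hd : ∀ n, ∃ k ≥ n, d k ≠ Fin.last b) :
    Real.digits (Real.ofDigits d) (b + 1) = d := by
  funext i
  unfold Real.digits
  induction i generalizing d with
  | zero =>
    obtain ⟨k, hk, hlast⟩ := hd 1
    have htail : Real.ofDigits (fun i => d (i + 1)) < 1 :=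
      ofDigits_lt_one (k := k - 1) (by rwa [Nat.sub_add_cancel hk])
    rw [ofDigits_eq_div, zero_add, pow_one, div_mul_cancel₀ _ (by positivity),
      add_comm ((d 0 : ℕ) : ℝ), Nat.floor_add_natCast (Real.ofDigits_nonneg _),
      Nat.floor_eq_zero.2 htail, zero_add]
    simp
  | succ i ih =>
    have htail : ∀ n, ∃ k ≥ n, d (k + 1) ≠ Fin.last b := fun n => by
      obtain ⟨k, hk, hlast⟩ := hd (n + 1)
      exact ⟨k - 1, by lia, by rwa [Nat.sub_add_cancel (by lia)]⟩
    have hshift : Real.ofDigits d * ((b + 1 : ℕ) : ℝ) ^ (i + 1 + 1) =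
        (Real.ofDigits fun i => d (i + 1)) * ((b + 1 : ℕ) : ℝ) ^ (i + 1) +
          ((d 0 * (b + 1) ^ (i + 1) : ℕ) : ℝ) := by
      rw [ofDigits_eq_div]
      push_cast
      field_simp
      ring
    rw [hshift, Nat.floor_add_natCast (mul_nonneg (Real.ofDigits_nonneg _) (by positivity)),
      ← ih htail]
    simp [Fin.ext_iff, pow_succ, ← mul_assoc]

lemma ofDigits_le_ofDigits {x y : ℕ → Fin b} {i : ℕ} (heq : ∀ l < i, x l = y l)
    (hlt : x i < y i) : Real.ofDigits x ≤ Real.ofDigits y := by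
  have hprefix : ∑ l ∈ Finset.range i, Real.ofDigitsTerm x l =
      ∑ l ∈ Finset.range i, Real.ofDigitsTerm y l :=
    Finset.sum_congr rfl fun l hl => by simp [Real.ofDigitsTerm, heq l (Finset.mem_range.1 hl)]
  have hdigit : ((x i : ℕ) : ℝ) + 1 ≤ (y i : ℕ) := by exact_mod_cast hlt
  rw [Real.ofDigits_eq_sum_add_ofDigits x (i + 1), Real.ofDigits_eq_sum_add_ofDigits y (i + 1),
    Finset.sum_range_succ, Finset.sum_range_succ, hprefix, add_assoc, add_assoc]
  refine add_le_add_right ?_ _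
  calc Real.ofDigitsTerm x i + ((b : ℝ) ^ (i + 1))⁻¹ * Real.ofDigits (fun l => x (l + (i + 1)))
      ≤ Real.ofDigitsTerm x i + ((b : ℝ) ^ (i + 1))⁻¹ * 1 := by
        gcongr
        exact Real.ofDigits_le_one _
    _ = ((x i : ℕ) + 1) * ((b : ℝ) ^ (i + 1))⁻¹ := by rw [Real.ofDigitsTerm]; ring
    _ ≤ Real.ofDigitsTerm y i := by rw [Real.ofDigitsTerm]; gcongr
    _ ≤ _ := le_add_of_nonneg_right (mul_nonneg (by positivity) (Real.ofDigits_nonneg _))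

lemma max_ofDigits {x y : ℕ → Fin 2} {i : ℕ} (heq : ∀ l < i, x l = y l) (hne : x i ≠ y i) :
    max (Real.ofDigits x) (Real.ofDigits y) =
      (x i : ℕ) * Real.ofDigits x + (y i : ℕ) * Real.ofDigits y := by
  rcases lt_or_gt_of_ne hne with hlt | hlt
  · obtain ⟨hx, hy⟩ : x i = 0 ∧ y i = 1 := by lia
    rw [max_eq_right (ofDigits_le_ofDigits heq hlt), hx, hy]
    simp
  · obtain ⟨hy, hx⟩ : y i = 0 ∧ x i = 1 := by lia
    rw [max_eq_left (ofDigits_le_ofDigits (fun l hl => (heq l hl).symm) hlt), hx, hy]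
    simp

end Digits

section FairBits

variable {Ω : Type*} [MeasurableSpace Ω] {P : Measure Ω}

lemma measurable_ofDigits {b : ℕ} {D : ℕ → Ω → Fin b} (hD : ∀ k, Measurable (D k)) :
    Measurable fun ω => Real.ofDigits fun k => D k ω :=
  Real.continuous_ofDigits.measurable.comp (measurable_pi_lambda _ hD)

lemma ofDigits_mem_Icc {b : ℕ} (d : ℕ → Fin b) : Real.ofDigits d ∈ Set.Icc (0 : ℝ) 1 :=
  ⟨Real.ofDigits_nonneg d, Real.ofDigits_le_one d⟩

lemma norm_ofDigits_le_one {b : ℕ} (d : ℕ → Fin b) : ‖Real.ofDigits d‖ ≤ 1 :=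
  (Real.norm_of_nonneg (Real.ofDigits_nonneg d)).trans_le (Real.ofDigits_le_one d)

lemma measurable_val_comp {b : ℕ} {D : Ω → Fin b} (hD : Measurable D) :
    Measurable fun ω => ((D ω : ℕ) : ℝ) :=
  (measurable_of_finite fun c : Fin b => ((c : ℕ) : ℝ)).comp hD

lemma hasSum_integral_mul_ofDigits {b : ℕ} {D : ℕ → Ω → Fin b} (hD : ∀ k, Measurable (D k))
    {Z : Ω → ℝ} (hZ : Integrable Z P) :
    HasSum (fun k => (∫ ω, Z ω * (D k ω : ℕ) ∂P) * ((b : ℝ) ^ (k + 1))⁻¹)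
      (∫ ω, Z ω * Real.ofDigits (fun k => D k ω) ∂P) := by
  have hsum (z : ℝ) (d : ℕ → Fin b) :
      HasSum (fun k => z * Real.ofDigitsTerm d k) (z * Real.ofDigits d) :=
    Real.summable_ofDigitsTerm.hasSum.mul_left z
  simp only [← integral_mul_const, mul_assoc]
  refine hasSum_integral_of_dominated_convergence
    (fun k ω => ‖Z ω‖ * Real.ofDigitsTerm (fun l => D l ω) k) (fun k => ?_)
    (fun k => ae_of_all _ fun ω => ?_) (ae_of_all _ fun ω => (hsum _ _).summable) ?_
    (ae_of_all _ fun ω => hsum _ _)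
  · exact hZ.aestronglyMeasurable.mul
      ((measurable_val_comp (hD k)).mul_const _).aestronglyMeasurable
  · exact (norm_mul_le _ _).trans_eq
      (congrArg _ (Real.norm_of_nonneg (Real.ofDigitsTerm_nonneg (digits := fun l => D l ω))))
  · simp only [(hsum _ _).tsum_eq]
    refine hZ.norm.mul_bdd (c := 1) (measurable_ofDigits hD).aestronglyMeasurable
      (ae_of_all _ fun ω => norm_ofDigits_le_one _)

lemma integrable_ofDigits [IsFiniteMeasure P] {b : ℕ} {D : ℕ → Ω → Fin b}
    (hD : ∀ k, Measurable (D k)) : Integrable (fun ω => Real.ofDigits fun k => D k ω) P :=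
  .of_mem_Icc 0 1 (measurable_ofDigits hD).aemeasurable (ae_of_all _ fun _ => ofDigits_mem_Icc _)

lemma hasSum_geometric_succ {r : ℝ} (h₀ : 0 ≤ r) (h₁ : r < 1) :
    HasSum (fun k : ℕ => r ^ (k + 1)) (r * (1 - r)⁻¹) := by
  simpa only [pow_succ'] using (hasSum_geometric_of_lt_one h₀ h₁).mul_left r

/-- The random variables `D 0, D 1, …` are independent tosses of a fair coin, so that the number
with these binary digits is uniformly distributed on the unit interval. -/
structure IsFairBits (P : Measure Ω) (D : ℕ → Ω → Fin 2) : Prop where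
  measurable : ∀ k, Measurable (D k)
  indep : iIndepFun D P
  uniform : ∀ k, P {ω | D k ω = 1} = 1 / 2

namespace IsFairBits

variable {D : ℕ → Ω → Fin 2} (hD : IsFairBits P D)
include hD

lemma isProbabilityMeasure : IsProbabilityMeasure P :=
  hD.indep.isProbabilityMeasure

lemma measurable_val (k : ℕ) : Measurable fun ω => ((D k ω : ℕ) : ℝ) :=
  measurable_val_comp (hD.measurable k)

lemma integrable_val (k : ℕ) : Integrable (fun ω => ((D k ω : ℕ) : ℝ)) P := by
  have := hD.isProbabilityMeasure
  refine .of_mem_Icc 0 1 (hD.measurable_val k).aemeasurable (ae_of_all _ fun ω => ?_)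
  exact ⟨Nat.cast_nonneg _, Nat.cast_le_one.2 (Nat.lt_succ_iff.1 (D k ω).2)⟩

lemma integral_val (k : ℕ) : ∫ ω, ((D k ω : ℕ) : ℝ) ∂P = 1 / 2 := by
  have hind : (fun ω => ((D k ω : ℕ) : ℝ)) = (D k ⁻¹' {1}).indicator 1 := by
    ext ω
    rcases Fin.exists_fin_two.1 ⟨D k ω, rfl⟩ with h | h <;> simp [h]
  rw [hind, integral_indicator_one (hD.measurable k (measurableSet_singleton 1)),
    measureReal_def, show P (D k ⁻¹' {1}) = 1 / 2 from hD.uniform k]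
  simp

lemma integral_val_mul_val {k l : ℕ} (hkl : k ≠ l) :
    ∫ ω, ((D k ω : ℕ) : ℝ) * (D l ω : ℕ) ∂P = 1 / 4 := by
  have hindep : IndepFun (fun ω => ((D k ω : ℕ) : ℝ)) (fun ω => ((D l ω : ℕ) : ℝ)) P :=
    (hD.indep.indepFun hkl).comp (measurable_val_comp measurable_id)
      (measurable_val_comp measurable_id)
  rw [hindep.integral_fun_mul_eq_mul_integral (hD.measurable_val k).aestronglyMeasurable
    (hD.measurable_val l).aestronglyMeasurable, hD.integral_val, hD.integral_val]
  norm_num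

lemma integral_val_mul_self (k : ℕ) : ∫ ω, ((D k ω : ℕ) : ℝ) * (D k ω : ℕ) ∂P = 1 / 2 := by
  have hsq (c : Fin 2) : ((c : ℕ) : ℝ) * (c : ℕ) = (c : ℕ) := by fin_cases c <;> simp
  simp only [hsq, hD.integral_val]

lemma integral_ofDigits : ∫ ω, Real.ofDigits (fun k => D k ω) ∂P = 1 / 2 := by
  have := hD.isProbabilityMeasure
  have hsum := hasSum_integral_mul_ofDigits hD.measurable (integrable_const (1 : ℝ) (μ := P))
  simp only [one_mul, hD.integral_val, ← inv_pow] at hsum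
  rw [hsum.unique ((hasSum_geometric_succ (by positivity) (by norm_num)).mul_left _)]
  norm_num

lemma integral_val_mul_ofDigits (k : ℕ) :
    ∫ ω, (D k ω : ℕ) * Real.ofDigits (fun l => D l ω) ∂P = 1 / 4 + (1 / 2) ^ (k + 1) / 4 := by
  have hgeom := (hasSum_geometric_succ (r := 1 / 2) (by norm_num) (by norm_num)).mul_left (1 / 4)
  have hsum := hasSum_integral_mul_ofDigits hD.measurable (hD.integrable_val k)
  rw [hsum.unique ((hgeom.add (hasSum_ite_eq k ((1 / 2) ^ (k + 1) / 4))).congr_fun fun l => ?_)]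
  · norm_num
  rw [Nat.cast_ofNat, ← inv_pow, ← one_div]
  rcases eq_or_ne l k with rfl | hl
  · rw [hD.integral_val_mul_self, if_pos rfl]
    ring
  · rw [hD.integral_val_mul_val hl.symm, if_neg hl, add_zero]

lemma integral_ofDigits_sq : ∫ ω, Real.ofDigits (fun k => D k ω) ^ 2 ∂P = 1 / 3 := by
  have := hD.isProbabilityMeasure
  have hgeom {r : ℝ} (h₀ : 0 ≤ r) (h₁ : r < 1) := (hasSum_geometric_succ h₀ h₁).mul_left (1 / 4)
  have hsum := hasSum_integral_mul_ofDigits hD.measurable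
    (integrable_ofDigits hD.measurable (P := P))
  simp only [sq]
  rw [hsum.unique (((hgeom (r := 1 / 2) (by norm_num) (by norm_num)).add
    (hgeom (r := 1 / 4) (by norm_num) (by norm_num))).congr_fun fun k => ?_)]
  · norm_num
  simp only [mul_comm (Real.ofDigits _), hD.integral_val_mul_ofDigits]
  rw [show (1 / 4 : ℝ) ^ (k + 1) = (1 / 2) ^ (k + 1) * (1 / 2) ^ (k + 1) by
    rw [← mul_pow]; norm_num, Nat.cast_ofNat, ← inv_pow, ← one_div]
  ring

lemma ae_ofDigits_ne_one : ∀ᵐ ω ∂P, Real.ofDigits (fun k => D k ω) ≠ 1 := by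
  have hle (n : ℕ) : P {ω | Real.ofDigits (fun k => D k ω) = 1} ≤ (1 / 2) ^ n := by
    calc P {ω | Real.ofDigits (fun k => D k ω) = 1}
        ≤ P (⋂ k ∈ Finset.range n, D k ⁻¹' {1}) := by
          refine measure_mono fun ω hω => Set.mem_iInter₂.2 fun k _ => ?_
          by_contra hk
          exact (ofDigits_lt_one (d := fun k => D k ω) hk).ne hω
      _ = ∏ k ∈ Finset.range n, P (D k ⁻¹' {1}) :=
          hD.indep.measure_inter_preimage_eq_mul _ fun _ _ => measurableSet_singleton 1
      _ = (1 / 2) ^ n :=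
          (Finset.prod_eq_pow_card fun k _ => hD.uniform k).trans (by rw [Finset.card_range])
  rw [ae_iff]
  simp only [ne_eq, not_not]
  refine le_antisymm (ge_of_tendsto' (ENNReal.tendsto_pow_atTop_nhds_zero_of_lt_one ?_) hle) zero_le
  simp

lemma integral_max_ofDigits {D' : ℕ → Ω → Fin 2} (hD' : IsFairBits P D') {i : ℕ}
    (heq : ∀ l < i, D l = D' l) (hne : ∀ ω, D i ω ≠ D' i ω) :
    ∫ ω, max (Real.ofDigits fun k => D k ω) (Real.ofDigits fun k => D' k ω) ∂P =
      1 / 2 + (1 / 2) ^ (i + 2) := by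
  have := hD.isProbabilityMeasure
  have hint {B : ℕ → Ω → Fin 2} (hB : IsFairBits P B) :
      Integrable (fun ω => ((B i ω : ℕ) : ℝ) * Real.ofDigits fun k => B k ω) P :=
    (hB.integrable_val i).mul_bdd (c := 1) (measurable_ofDigits hB.measurable).aestronglyMeasurable
      (ae_of_all _ fun ω => norm_ofDigits_le_one _)
  calc ∫ ω, max (Real.ofDigits fun k => D k ω) (Real.ofDigits fun k => D' k ω) ∂P
      = ∫ ω, ((D i ω : ℕ) * Real.ofDigits (fun k => D k ω) +
          (D' i ω : ℕ) * Real.ofDigits (fun k => D' k ω)) ∂P :=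
        integral_congr_ae (ae_of_all _ fun ω =>
          max_ofDigits (fun l hl => congrFun (heq l hl) ω) (hne ω))
    _ = 1 / 2 + (1 / 2) ^ (i + 2) := by
        rw [integral_add (hint hD) (hint hD'), hD.integral_val_mul_ofDigits,
          hD'.integral_val_mul_ofDigits]
        ring

end IsFairBits

end FairBits

section Scrambling

variable {Ω : Type*} [MeasurableSpace Ω] {P : Measure Ω}

lemma iIndepFun_curry {ι κ E : Type*} [MeasurableSpace E] {X : ι → κ → Ω → E}
    (hX : ∀ i j, Measurable (X i j)) (hind : iIndepFun (fun p : ι × κ => X p.1 p.2) P) :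
    iIndepFun (fun i ω j => X i j ω) P := by
  have := hind.isProbabilityMeasure
  have hprob : ∀ i j, IsProbabilityMeasure (P.map (X i j)) := fun i j =>
    Measure.isProbabilityMeasure_map (hX i j).aemeasurable
  have hsection (i : ι) : P.map (fun ω j => X i j ω) = Measure.infinitePi fun j => P.map (X i j) :=
    (iIndepFun_iff_map_fun_eq_infinitePi_map (hX i)).1
      (hind.precomp (g := fun j => (i, j)) fun _ _ h => (Prod.ext_iff.1 h).2)
  have hall := (iIndepFun_iff_map_fun_eq_infinitePi_map fun p : ι × κ => hX p.1 p.2).1 hind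
  rw [iIndepFun_iff_map_fun_eq_infinitePi_map fun i => measurable_pi_lambda _ (hX i)]
  simp only [hsection]
  rw [← Measure.infinitePi_map_curry (fun i j => P.map (X i j)), ← hall,
    Measure.map_map (MeasurableEquiv.measurable _)
      (measurable_pi_lambda _ fun p : ι × κ => hX p.1 p.2)]
  rfl

/-- The digits of the scrambled number, for a number with the binary digits `x`. -/
def scrambledDigits (σ : List (Fin 2) → Equiv.Perm (Fin 2)) (x : ℕ → Fin 2) (k : ℕ) : Fin 2 :=
  σ (List.ofFn fun i : Fin k => x i) (x k)

lemma ofFn_congr {α : Type*} {x y : ℕ → α} {k : ℕ} (h : ∀ l < k, x l = y l) :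
    (List.ofFn fun i : Fin k => x i) = List.ofFn fun i : Fin k => y i :=
  congrArg List.ofFn (funext fun i => h i i.2)

lemma scrambledDigits_eq_of_lt {x y : ℕ → Fin 2} {i l : ℕ} (heq : ∀ l < i, x l = y l)
    (hl : l < i) (σ : List (Fin 2) → Equiv.Perm (Fin 2)) :
    scrambledDigits σ x l = scrambledDigits σ y l := by
  rw [scrambledDigits, scrambledDigits, ofFn_congr fun j hj => heq j (hj.trans hl), heq l hl]

lemma scrambledDigits_ne {x y : ℕ → Fin 2} {i : ℕ} (heq : ∀ l < i, x l = y l) (hne : x i ≠ y i)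
    (σ : List (Fin 2) → Equiv.Perm (Fin 2)) : scrambledDigits σ x i ≠ scrambledDigits σ y i := by
  rw [scrambledDigits, scrambledDigits, ofFn_congr heq]
  exact (σ _).injective.ne hne

lemma exists_forall_perm_apply_eq_iff (c d : Fin 2) :
    ∃ τ : Equiv.Perm (Fin 2), ∀ ρ : Equiv.Perm (Fin 2), ρ c = d ↔ ρ = τ := by
  decide +revert

scoped instance : MeasurableSpace (Equiv.Perm (Fin 2)) := ⊤

scoped instance : DiscreteMeasurableSpace (Equiv.Perm (Fin 2)) := ⟨fun _ => trivial⟩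

lemma measurable_scramble (x : ℝ) :
    Measurable fun σ : List (Fin 2) → Equiv.Perm (Fin 2) => scramble σ x :=
  measurable_ofDigits fun k => (measurable_of_finite fun τ : Equiv.Perm (Fin 2) =>
    τ (Real.digits x 2 k)).comp (measurable_pi_apply _)

lemma scramble_mem_Icc (σ : List (Fin 2) → Equiv.Perm (Fin 2)) (x : ℝ) :
    scramble σ x ∈ Set.Icc (0 : ℝ) 1 :=
  ofDigits_mem_Icc _

namespace IsOwenScrambling

variable {s : ℕ} {π : Fin s → List (Fin 2) → Ω → Equiv.Perm (Fin 2)} (hπ : IsOwenScrambling P π)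
include hπ

lemma isFairBits (j : Fin s) (x : ℕ → Fin 2) :
    IsFairBits P fun k ω => scrambledDigits (fun a => π j a ω) x k where
  measurable k := (measurable_of_finite fun τ : Equiv.Perm (Fin 2) => τ (x k)).comp
    (hπ.measurable j _)
  indep := by
    have hinj : Function.Injective fun k : ℕ => (j, List.ofFn fun i : Fin k => x i) :=
      fun k l h => by simpa using congrArg (fun a => a.2.length) h
    exact (hπ.indep.precomp hinj).comp (fun k τ => τ (x k)) fun k => measurable_of_finite _
  uniform k := by
    obtain ⟨τ, hτ⟩ := exists_forall_perm_apply_eq_iff (x k) 1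
    simp only [scrambledDigits, hτ, hπ.uniform]

lemma iIndepFun_coordinate : iIndepFun (fun j ω a => π j a ω) P :=
  iIndepFun_curry hπ.measurable hπ.indep

lemma measurable_scramble_coordinate (j : Fin s) (x : ℝ) :
    Measurable fun ω => scramble (fun a => π j a ω) x :=
  (measurable_scramble x).comp (measurable_pi_lambda _ (hπ.measurable j))

lemma integrable_scramble (j : Fin s) (x : ℝ) :
    Integrable (fun ω => scramble (fun a => π j a ω) x) P := by
  have := hπ.indep.isProbabilityMeasure
  exact integrable_ofDigits (hπ.isFairBits j _).measurable

lemma ae_scramble_ne_one (j : Fin s) (x : ℝ) : ∀ᵐ ω ∂P, scramble (fun a => π j a ω) x ≠ 1 :=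
  (hπ.isFairBits j _).ae_ofDigits_ne_one

lemma integral_scramble_sq (j : Fin s) (x : ℝ) :
    ∫ ω, scramble (fun a => π j a ω) x ^ 2 ∂P = 1 / 3 :=
  (hπ.isFairBits j _).integral_ofDigits_sq

lemma integral_one_sub_max_scramble (j : Fin s) (x y : ℝ) :
    ∫ ω, (1 - max (scramble (fun a => π j a ω) x) (scramble (fun a => π j a ω) y)) ∂P =
      walshKernel (Real.digits x 2) (Real.digits y 2) / 3 := by
  have := hπ.indep.isProbabilityMeasure
  have hmax_int : Integrable (fun ω => max (scramble (fun a => π j a ω) x)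
      (scramble (fun a => π j a ω) y)) P :=
    (hπ.integrable_scramble j x).sup (hπ.integrable_scramble j y)
  rw [integral_sub (integrable_const _) hmax_int, integral_const, probReal_univ, one_smul]
  by_cases hxy : Real.digits x 2 = Real.digits y 2
  · have hscramble (σ : List (Fin 2) → Equiv.Perm (Fin 2)) : scramble σ y = scramble σ x := by
      rw [scramble, scramble, hxy]
    simp only [hscramble, max_self, ← hxy, walshKernel_self]
    rw [show ∫ ω, scramble (fun a => π j a ω) x ∂P = 1 / 2 from
      (hπ.isFairBits j _).integral_ofDigits]
    norm_num
  · obtain ⟨i, hne, heq⟩ : ∃ i, Real.digits x 2 i ≠ Real.digits y 2 i ∧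
        ∀ l < i, Real.digits x 2 l = Real.digits y 2 l := by
      have hex := Function.ne_iff.1 hxy
      exact ⟨Nat.find hex, Nat.find_spec hex, fun l hl => not_not.1 (Nat.find_min hex hl)⟩
    have hmax := (hπ.isFairBits j (Real.digits x 2)).integral_max_ofDigits (hπ.isFairBits j _)
      (fun l hl => funext fun ω => scrambledDigits_eq_of_lt heq hl _)
      fun ω => scrambledDigits_ne heq hne _
    rw [walshKernel_of_first_ne heq hne]
    refine (congrArg (1 - ·) hmax).trans ?_
    ring

end IsOwenScrambling

end Scrambling

section Warnock

lemma extendOne_coe {s : ℕ} {u : Finset (Fin s)} (t : u → ℝ) (j : u) : extendOne u t j = t j := by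
  simp [extendOne]

lemma extendOne_of_notMem {s : ℕ} {u : Finset (Fin s)} (t : u → ℝ) {j : Fin s} (hj : j ∉ u) :
    extendOne u t j = 1 := by
  simp [extendOne, hj]

lemma prod_extendOne {s : ℕ} {u : Finset (Fin s)} (t : u → ℝ) :
    ∏ j, extendOne u t j = ∏ j, t j := by
  rw [← Finset.prod_subset u.subset_univ fun j _ hj => extendOne_of_notMem t hj,
    ← Finset.prod_coe_sort]
  simp only [extendOne_coe]

lemma forall_mem_Ico_extendOne_iff {s : ℕ} {u : Finset (Fin s)} {y : Fin s → ℝ}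
    (hy : ∀ j, y j ∈ Set.Ico (0 : ℝ) 1) (t : u → ℝ) :
    (∀ j, y j ∈ Set.Ico 0 (extendOne u t j)) ↔ ∀ j : u, y j < t j := by
  refine ⟨fun h j => extendOne_coe t j ▸ (h j).2, fun h j => ⟨(hy j).1, ?_⟩⟩
  by_cases hj : j ∈ u
  · exact (h ⟨j, hj⟩).trans_eq (extendOne_coe t ⟨j, hj⟩).symm
  · exact (hy j).2.trans_eq (extendOne_of_notMem t hj).symm

lemma localDiscrepancy_extendOne {N s : ℕ} {x : Fin N → Fin s → ℝ}
    (hx : ∀ n j, x n j ∈ Set.Ico (0 : ℝ) 1) {u : Finset (Fin s)} (t : u → ℝ) :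
    localDiscrepancy x (extendOne u t) =
      (∑ n, ∏ j : u, (Set.Ioi (x n j)).indicator 1 (t j)) / N - ∏ j, t j := by
  classical
  rw [localDiscrepancy, prod_extendOne]
  simp only [forall_mem_Ico_extendOne_iff (hx _), Set.indicator_apply, Set.mem_Ioi, Pi.one_apply,
    Finset.prod_boole, Finset.mem_univ, true_imp_iff, Finset.sum_boole, Nat.card_eq_fintype_card,
    Fintype.card_subtype]

lemma integral_sq_sum_div_sub {α ι : Type*} [MeasurableSpace α] [Fintype ι] {μ : Measure α}
    {f : ι → α → ℝ} {g : α → ℝ} (hf : ∀ i, MemLp (f i) 2 μ) (hg : MemLp g 2 μ) (c : ℝ) :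
    ∫ a, ((∑ i, f i a) / c - g a) ^ 2 ∂μ =
      (∑ i, ∑ j, ∫ a, f i a * f j a ∂μ) / c ^ 2 - 2 * (∑ i, ∫ a, f i a * g a ∂μ) / c +
        ∫ a, g a ^ 2 ∂μ := by
  have hff (i j : ι) : Integrable (fun a => f i a * f j a) μ := (hf i).integrable_mul (hf j)
  have hfg (i : ι) : Integrable (fun a => f i a * g a) μ := (hf i).integrable_mul hg
  have hff_sum (i : ι) : Integrable (fun a => ∑ j, f i a * f j a) μ :=
    integrable_finsetSum _ fun j _ => hff i j
  have hsq (a : α) : ((∑ i, f i a) / c - g a) ^ 2 =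
      (∑ i, ∑ j, f i a * f j a) / c ^ 2 - 2 * (∑ i, f i a * g a) / c + g a ^ 2 := by
    rw [← Finset.sum_mul_sum, ← Finset.sum_mul]
    ring
  have hint₁ := (integrable_finsetSum Finset.univ fun i _ => hff_sum i).div_const (c ^ 2)
  have hint₂ := ((integrable_finsetSum Finset.univ fun i _ => hfg i).const_mul 2).div_const c
  simp only [hsq]
  refine (integral_add (hint₁.sub hint₂) hg.integrable_sq).trans ?_
  rw [Pi.sub_def, integral_sub hint₁ hint₂, integral_div, integral_div, integral_const_mul,
    integral_finsetSum _ fun i _ => hff_sum i, integral_finsetSum _ fun i _ => hfg i]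
  simp only [integral_finsetSum _ fun j _ => hff _ j]

variable {ι : Type*} [Fintype ι]

lemma setIntegral_Icc_prod (f : ι → ℝ → ℝ) :
    ∫ t in Set.Icc (0 : ι → ℝ) 1, ∏ j, f j (t j) = ∏ j, ∫ t in Set.Icc (0 : ℝ) 1, f j t := by
  rw [← Set.pi_univ_Icc, volume_pi, Measure.restrict_pi_pi]
  exact integral_fintype_prod_eq_prod _

lemma memLp_Icc_prod {f : ι → ℝ → ℝ} (hf : ∀ j, Measurable (f j))
    (hmem : ∀ j, ∀ t ∈ Set.Icc (0 : ℝ) 1, f j t ∈ Set.Icc (0 : ℝ) 1) (p : ENNReal) :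
    MemLp (fun t : ι → ℝ => ∏ j, f j (t j)) p (volume.restrict (Set.Icc (0 : ι → ℝ) 1)) := by
  have : IsFiniteMeasure ((volume : Measure (ι → ℝ)).restrict (Set.Icc 0 1)) :=
    isFiniteMeasure_restrict.2 isCompact_Icc.measure_ne_top
  have hcube : ∀ᵐ t : ι → ℝ ∂volume.restrict (Set.Icc 0 1), t ∈ Set.Icc 0 1 :=
    ae_restrict_mem measurableSet_Icc
  refine memLp_of_bounded (a := 0) (b := 1) (hcube.mono fun t ht =>
    unitInterval.prod_mem fun j _ => hmem j (t j) ⟨ht.1 j, ht.2 j⟩) ?_ p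
  exact (Finset.measurable_fun_prod _ fun j _ =>
    (hf j).comp (measurable_pi_apply j)).aestronglyMeasurable

lemma setIntegral_Icc_indicator_Ioi_mul {a : ℝ} (ha : a ∈ Set.Icc (0 : ℝ) 1) (f : ℝ → ℝ) :
    ∫ t in Set.Icc (0 : ℝ) 1, (Set.Ioi a).indicator 1 t * f t = ∫ t in a..1, f t := by
  have hset : Set.Icc (0 : ℝ) 1 ∩ Set.Ioi a = Set.Ioc a 1 := by
    ext t
    exact ⟨fun h => ⟨h.2, h.1.2⟩, fun h => ⟨⟨ha.1.trans h.1.le, h.2⟩, h.1⟩⟩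
  have hind (t : ℝ) : (Set.Ioi a).indicator 1 t * f t = (Set.Ioi a).indicator f t := by
    simp [Set.indicator_apply]
  simp only [hind]
  rw [setIntegral_indicator measurableSet_Ioi, hset, intervalIntegral.integral_of_le ha.2]

lemma setIntegral_Icc_indicator_Ioi_mul_indicator_Ioi {a b : ℝ} (ha : a ∈ Set.Icc (0 : ℝ) 1)
    (hb : b ∈ Set.Icc (0 : ℝ) 1) :
    ∫ t in Set.Icc (0 : ℝ) 1, (Set.Ioi a).indicator 1 t * (Set.Ioi b).indicator 1 t =
      1 - max a b := by
  have hind (t : ℝ) : (Set.Ioi a).indicator (1 : ℝ → ℝ) t * (Set.Ioi b).indicator 1 t =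
      (Set.Ioi (max a b)).indicator 1 t * 1 := by
    rw [mul_one, ← Set.Ioi_inter_Ioi, Set.inter_indicator_one, Pi.mul_apply]
  simp only [hind]
  rw [setIntegral_Icc_indicator_Ioi_mul (f := fun _ => 1)
    ⟨ha.1.trans (le_max_left _ _), max_le ha.2 hb.2⟩]
  simp

lemma setIntegral_sq_localDiscrepancy {N s : ℕ} {x : Fin N → Fin s → ℝ}
    (hx : ∀ n j, x n j ∈ Set.Ico (0 : ℝ) 1) (u : Finset (Fin s)) :
    ∫ t in Set.Icc (0 : u → ℝ) 1, |localDiscrepancy x (extendOne u t)| ^ 2 =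
      (∑ n, ∑ n', ∏ j : u, (1 - max (x n j) (x n' j))) / N ^ 2 -
        2 * (∑ n, ∏ j : u, (1 - x n j ^ 2) / 2) / N + (1 / 3) ^ u.card := by
  have hmem (n : Fin N) (j : Fin s) : x n j ∈ Set.Icc (0 : ℝ) 1 :=
    Set.Ico_subset_Icc_self (hx n j)
  have hsq : ∫ t in Set.Icc (0 : ℝ) 1, t ^ 2 = 1 / 3 := by
    rw [integral_Icc_eq_integral_Ioc, ← intervalIntegral.integral_of_le zero_le_one, integral_pow]
    norm_num
  have hind_mem (a t : ℝ) : (Set.Ioi a).indicator (1 : ℝ → ℝ) t ∈ Set.Icc 0 1 :=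
    ⟨Set.indicator_nonneg (fun _ _ => zero_le_one) _,
      Set.indicator_le_self' (fun _ _ => zero_le_one) _⟩
  simp only [localDiscrepancy_extendOne hx, sq_abs]
  rw [integral_sq_sum_div_sub
    (fun n => memLp_Icc_prod (f := fun (j : u) => (Set.Ioi (x n j)).indicator 1)
      (fun _ => measurable_const.indicator measurableSet_Ioi) (fun _ t _ => hind_mem _ t) 2)
    (memLp_Icc_prod (f := fun _ t => t) (fun _ => measurable_id) (fun _ _ ht => ht) 2)]
  simp only [← Finset.prod_mul_distrib, ← Finset.prod_pow]
  rw [setIntegral_Icc_prod fun (_ : u) t => t ^ 2]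
  congr 1
  · congr! 5 with n _ n' _ n _
    · rw [setIntegral_Icc_prod fun (j : u) t =>
        (Set.Ioi (x n j)).indicator 1 t * (Set.Ioi (x n' j)).indicator 1 t]
      simp only [setIntegral_Icc_indicator_Ioi_mul_indicator_Ioi (hmem _ _) (hmem _ _)]
    · rw [setIntegral_Icc_prod fun (j : u) t => (Set.Ioi (x n j)).indicator 1 t * t]
      simp only [setIntegral_Icc_indicator_Ioi_mul (hmem _ _) fun t => t, integral_id, one_pow]
  · simp [hsq]

end Warnock

section Expectation

variable {Ω : Type*} [MeasurableSpace Ω] {P : Measure Ω}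

lemma measurable_one_sub_max_scramble (x y : ℝ) :
    Measurable fun σ : List (Fin 2) → Equiv.Perm (Fin 2) =>
      1 - max (scramble σ x) (scramble σ y) :=
  measurable_const.sub ((measurable_scramble x).max (measurable_scramble y))

lemma measurable_one_sub_sq_scramble_div_two (x : ℝ) :
    Measurable fun σ : List (Fin 2) → Equiv.Perm (Fin 2) => (1 - scramble σ x ^ 2) / 2 :=
  (measurable_const.sub ((measurable_scramble x).pow_const 2)).div_const 2

namespace IsOwenScrambling

variable {s : ℕ} {π : Fin s → List (Fin 2) → Ω → Equiv.Perm (Fin 2)} (hπ : IsOwenScrambling P π)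
include hπ

lemma integral_prod (u : Finset (Fin s)) {f : Fin s → (List (Fin 2) → Equiv.Perm (Fin 2)) → ℝ}
    (hf : ∀ j, Measurable (f j)) :
    ∫ ω, ∏ j : u, f j (fun a => π j a ω) ∂P = ∏ j ∈ u, ∫ ω, f j (fun a => π j a ω) ∂P := by
  rw [← Finset.prod_coe_sort]
  exact (hπ.iIndepFun_coordinate.precomp (g := ((↑) : u → Fin s))
    Subtype.val_injective).integral_fun_prod_comp
      (fun j => (measurable_pi_lambda _ (hπ.measurable j)).aemeasurable)
      fun j => (hf j).aestronglyMeasurable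

lemma integrable_prod (u : Finset (Fin s)) {f : Fin s → (List (Fin 2) → Equiv.Perm (Fin 2)) → ℝ}
    (hf : ∀ j, Measurable (f j)) (hmem : ∀ j σ, f j σ ∈ Set.Icc (0 : ℝ) 1) :
    Integrable (fun ω => ∏ j : u, f j (fun a => π j a ω)) P := by
  have := hπ.indep.isProbabilityMeasure
  refine .of_mem_Icc 0 1 (Finset.measurable_fun_prod _ fun (j : u) _ =>
    (hf j).comp (measurable_pi_lambda _ (hπ.measurable j))).aemeasurable (ae_of_all _ fun ω => ?_)
  exact unitInterval.prod_mem fun j _ => hmem j _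

lemma integrable_prod_one_sub_max (u : Finset (Fin s)) (x y : Fin s → ℝ) :
    Integrable (fun ω => ∏ j : u, (1 - max (scramble (fun a => π j a ω) (x j))
      (scramble (fun a => π j a ω) (y j)))) P :=
  hπ.integrable_prod u (f := fun j σ => 1 - max (scramble σ (x j)) (scramble σ (y j)))
    (fun j => measurable_one_sub_max_scramble (x j) (y j))
    fun _ _ => Set.Icc.mem_iff_one_sub_mem.1
      ⟨(scramble_mem_Icc _ _).1.trans (le_max_left _ _),
        max_le (scramble_mem_Icc _ _).2 (scramble_mem_Icc _ _).2⟩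

lemma integral_prod_one_sub_max (u : Finset (Fin s)) (x y : Fin s → ℝ) :
    ∫ ω, ∏ j : u, (1 - max (scramble (fun a => π j a ω) (x j))
        (scramble (fun a => π j a ω) (y j))) ∂P =
      (∏ j ∈ u, walshKernel (Real.digits (x j) 2) (Real.digits (y j) 2)) / 3 ^ u.card := by
  rw [hπ.integral_prod u (f := fun j σ => 1 - max (scramble σ (x j)) (scramble σ (y j)))
    fun j => measurable_one_sub_max_scramble (x j) (y j)]
  simp only [hπ.integral_one_sub_max_scramble, Finset.prod_div_distrib, Finset.prod_const]

lemma integrable_prod_one_sub_sq (u : Finset (Fin s)) (x : Fin s → ℝ) :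
    Integrable (fun ω => ∏ j : u, (1 - scramble (fun a => π j a ω) (x j) ^ 2) / 2) P := by
  refine hπ.integrable_prod u (f := fun j σ => (1 - scramble σ (x j) ^ 2) / 2)
    (fun j => measurable_one_sub_sq_scramble_div_two (x j)) fun j σ => ?_
  have hx := scramble_mem_Icc σ (x j)
  have hsq := pow_le_one₀ hx.1 hx.2 (n := 2)
  exact ⟨by linarith, by linarith [sq_nonneg (scramble σ (x j))]⟩

lemma integral_prod_one_sub_sq (u : Finset (Fin s)) (x : Fin s → ℝ) :
    ∫ ω, ∏ j : u, (1 - scramble (fun a => π j a ω) (x j) ^ 2) / 2 ∂P = (1 / 3) ^ u.card := by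
  have := hπ.indep.isProbabilityMeasure
  have hone (j : Fin s) : ∫ ω, (1 - scramble (fun a => π j a ω) (x j) ^ 2) / 2 ∂P = 1 / 3 := by
    have hsq_int : Integrable (fun ω => scramble (fun a => π j a ω) (x j) ^ 2) P :=
      .of_mem_Icc 0 1 ((hπ.measurable_scramble_coordinate j _).pow_const 2).aemeasurable
        (ae_of_all _ fun ω =>
          ⟨sq_nonneg _, pow_le_one₀ (scramble_mem_Icc _ _).1 (scramble_mem_Icc _ _).2⟩)
    rw [integral_div, integral_sub (integrable_const _) hsq_int, hπ.integral_scramble_sq,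
      integral_const, probReal_univ]
    norm_num
  rw [hπ.integral_prod u (f := fun j σ => (1 - scramble σ (x j) ^ 2) / 2)
    fun j => measurable_one_sub_sq_scramble_div_two (x j)]
  simp only [hone, Finset.prod_const]

lemma ae_setIntegral_sq_localDiscrepancy {N : ℕ} (x : Fin N → Fin s → ℝ) (u : Finset (Fin s)) :
    (fun ω => ∫ t in Set.Icc (0 : u → ℝ) 1,
        |localDiscrepancy (scramblePoints (fun j a => π j a ω) x) (extendOne u t)| ^ 2) =ᵐ[P]
      fun ω => (∑ n, ∑ n', ∏ j : u, (1 - max (scramble (fun a => π j a ω) (x n j))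
          (scramble (fun a => π j a ω) (x n' j)))) / N ^ 2 -
        2 * (∑ n, ∏ j : u, (1 - scramble (fun a => π j a ω) (x n j) ^ 2) / 2) / N +
        (1 / 3) ^ u.card := by
  filter_upwards [ae_all_iff.2 fun n => ae_all_iff.2 fun j => hπ.ae_scramble_ne_one j (x n j)]
    with ω hω
  exact setIntegral_sq_localDiscrepancy (fun n j =>
    ⟨(scramble_mem_Icc _ _).1, (scramble_mem_Icc _ _).2.lt_of_ne (hω n j)⟩) u

lemma integrable_setIntegral_sq_localDiscrepancy {N : ℕ} (x : Fin N → Fin s → ℝ)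
    (u : Finset (Fin s)) :
    Integrable (fun ω => ∫ t in Set.Icc (0 : u → ℝ) 1,
      |localDiscrepancy (scramblePoints (fun j a => π j a ω) x) (extendOne u t)| ^ 2) P := by
  have := hπ.indep.isProbabilityMeasure
  refine Integrable.congr ?_ (hπ.ae_setIntegral_sq_localDiscrepancy x u).symm
  exact (((integrable_finsetSum _ fun n _ => integrable_finsetSum _ fun n' _ =>
      hπ.integrable_prod_one_sub_max u (x n) (x n')).div_const _).sub
    (((integrable_finsetSum _ fun n _ =>
      hπ.integrable_prod_one_sub_sq u (x n)).const_mul 2).div_const _)).add (integrable_const _)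

lemma integral_setIntegral_sq_localDiscrepancy {N : ℕ} (hN : N ≠ 0) (x : Fin N → Fin s → ℝ)
    (u : Finset (Fin s)) :
    ∫ ω, (∫ t in Set.Icc (0 : u → ℝ) 1,
        |localDiscrepancy (scramblePoints (fun j a => π j a ω) x) (extendOne u t)| ^ 2) ∂P =
      ((∑ n, ∑ n', ∏ j ∈ u, walshKernel (Real.digits (x n j) 2) (Real.digits (x n' j) 2)) / N ^ 2
        - 1) / 3 ^ u.card := by
  have := hπ.indep.isProbabilityMeasure
  have hmax (n : Fin N) := integrable_finsetSum Finset.univ fun n' _ =>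
    hπ.integrable_prod_one_sub_max u (x n) (x n')
  have hmax_sum := (integrable_finsetSum Finset.univ fun n _ => hmax n).div_const ((N : ℝ) ^ 2)
  have hsq (n : Fin N) := hπ.integrable_prod_one_sub_sq u (x n)
  have hsq_sum := ((integrable_finsetSum Finset.univ fun n _ => hsq n).const_mul 2).div_const
    (N : ℝ)
  rw [integral_congr_ae (hπ.ae_setIntegral_sq_localDiscrepancy x u)]
  refine (integral_add (hmax_sum.sub hsq_sum) (integrable_const _)).trans ?_
  rw [Pi.sub_def, integral_sub hmax_sum hsq_sum, integral_div, integral_div, integral_const_mul,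
    integral_finsetSum _ fun n _ => hmax n, integral_finsetSum _ fun n _ => hsq n]
  simp only [integral_finsetSum _ fun n' _ => hπ.integrable_prod_one_sub_max u (x _) (x n'),
    hπ.integral_prod_one_sub_max, hπ.integral_prod_one_sub_sq, ← Finset.sum_div,
    Finset.sum_const, Finset.card_univ, Fintype.card_fin, integral_const, probReal_univ, one_smul,
    nsmul_eq_mul, div_pow, one_pow]
  have hN' : (N : ℝ) ≠ 0 := Nat.cast_ne_zero.2 hN
  field_simp
  ring

end IsOwenScrambling

end Expectation

section WalshMeans

lemma prod_extendZero {s : ℕ} {R : Type*} [CommMonoid R] (v : Finset (Fin s)) (k : v → ℕ+)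
    {f : Fin s → ℕ → R} (hf : ∀ j, f j 0 = 1) :
    ∏ j, f j (extendZero v k j) = ∏ j : v, f j (k j) := by
  rw [← Finset.prod_subset v.subset_univ fun j _ hj => by simp [extendZero, hj, hf],
    ← Finset.prod_coe_sort]
  simp [extendZero]

/-- The mean over the points of the multivariate Walsh function with index `k`. -/
def walshMean {N s : ℕ} (x : Fin N → Fin s → ℝ) (k : Fin s → ℕ) : ℝ :=
  (∑ n, ∏ j, walsh (k j) (Real.digits (x n j) 2)) / N

/-- The sum of `ψ(k)` times the squared Walsh mean, over the indices `k` whose set of nonzero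
components is `v`. -/
def walshEnergy {N s : ℕ} (x : Fin N → Fin s → ℝ) (v : Finset (Fin s)) : ℝ :=
  ∑' k : v → ℕ+, psiVec (extendZero v k) * walshMean x (extendZero v k) ^ 2

variable {N s : ℕ} (x : Fin N → Fin s → ℝ)

lemma hasSum_prod_walshKernel_sub_one (y z : Fin s → ℝ) (v : Finset (Fin s)) :
    HasSum (fun k : v → ℕ+ => psiVec (extendZero v k) *
        ((∏ j, walsh (extendZero v k j) (Real.digits (y j) 2)) *
          ∏ j, walsh (extendZero v k j) (Real.digits (z j) 2)))
      (∏ j ∈ v, (walshKernel (Real.digits (y j) 2) (Real.digits (z j) 2) - 1)) := by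
  rw [← Finset.prod_coe_sort]
  refine (hasSum_prod_pi (fun j : v => ?_) fun j : v =>
    hasSum_pnat_walshKernel_sub_one (Real.digits (y j) 2) (Real.digits (z j) 2)).congr_fun
      fun k => ?_
  · simp only [norm_psi_mul_walsh_mul_walsh]
    exact summable_psi.comp_injective PNat.coe_injective
  · rw [psiVec, ← Finset.prod_mul_distrib, ← Finset.prod_mul_distrib]
    exact prod_extendZero v k
      (f := fun j l => psi l * (walsh l (Real.digits (y j) 2) * walsh l (Real.digits (z j) 2)))
      fun j => by simp [psi_zero, walsh_zero]

lemma hasSum_psiVec_mul_walshMean_sq (v : Finset (Fin s)) :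
    HasSum (fun k : v → ℕ+ => psiVec (extendZero v k) * walshMean x (extendZero v k) ^ 2)
      ((∑ n, ∑ n', ∏ j ∈ v, (walshKernel (Real.digits (x n j) 2) (Real.digits (x n' j) 2) - 1)) /
        N ^ 2) := by
  have hpairs := (hasSum_sum (s := Finset.univ) fun n _ => hasSum_sum (s := Finset.univ)
    fun n' _ => hasSum_prod_walshKernel_sub_one (x n) (x n') v).div_const ((N : ℝ) ^ 2)
  refine hpairs.congr_fun fun k => ?_
  simp only [← Finset.mul_sum, ← Finset.sum_mul]
  rw [walshMean]
  ring

lemma walshEnergy_eq (v : Finset (Fin s)) :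
    walshEnergy x v = (∑ n, ∑ n', ∏ j ∈ v,
      (walshKernel (Real.digits (x n j) 2) (Real.digits (x n' j) 2) - 1)) / N ^ 2 :=
  (hasSum_psiVec_mul_walshMean_sq x v).tsum_eq

lemma sum_powerset_walshEnergy (u : Finset (Fin s)) :
    ∑ v ∈ u.powerset, walshEnergy x v =
      (∑ n, ∑ n', ∏ j ∈ u, walshKernel (Real.digits (x n j) 2) (Real.digits (x n' j) 2)) /
        N ^ 2 := by
  simp only [walshEnergy_eq]
  rw [← Finset.sum_div, Finset.sum_comm]
  congr! 2 with n
  rw [Finset.sum_comm]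
  congr! 1 with n'
  rw [← Finset.prod_add_one]
  simp only [sub_add_cancel]

lemma sum_nonempty_walshEnergy (hN : N ≠ 0) (u : Finset (Fin s)) :
    ∑ v ∈ u.powerset with v.Nonempty, walshEnergy x v =
      (∑ n, ∑ n', ∏ j ∈ u, walshKernel (Real.digits (x n j) 2) (Real.digits (x n' j) 2)) /
        N ^ 2 - 1 := by
  have hN' : (N : ℝ) ≠ 0 := Nat.cast_ne_zero.2 hN
  have hempty : walshEnergy x ∅ = 1 := by
    simp [walshEnergy_eq, ← sq, hN']
  have herase : {v ∈ u.powerset | v.Nonempty} = u.powerset.erase ∅ := by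
    ext v
    simp [Finset.nonempty_iff_ne_empty, and_comm]
  rw [herase, Finset.sum_erase_eq_sub (Finset.empty_mem_powerset u), sum_powerset_walshEnergy,
    hempty]

lemma sum_gammaTilde_mul (γ S : Finset (Fin s) → ℝ) :
    ∑ v with v.Nonempty, gammaTilde γ v * S v =
      ∑ u with u.Nonempty, γ u * ((∑ v ∈ u.powerset with v.Nonempty, S v) / 3 ^ u.card) := by
  simp only [gammaTilde, Finset.sum_mul, Finset.sum_div, Finset.mul_sum]
  rw [Finset.sum_comm' (t' := Finset.univ.filter Finset.Nonempty)
    (s' := fun u => u.powerset.filter Finset.Nonempty)]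
  · congr! 2
    ring
  · intro v u
    simp only [Finset.mem_filter, Finset.mem_univ, Finset.mem_powerset, true_and]
    exact ⟨fun h => ⟨⟨h.2, h.1⟩, h.1.mono h.2⟩, fun h => ⟨h.1.2, h.1.1⟩⟩

lemma sq_weightedL2Discrepancy {γ : Finset (Fin s) → ℝ} (hγ : ∀ u, 0 ≤ γ u) :
    weightedL2Discrepancy γ x ^ 2 = ∑ u with u.Nonempty,
      γ u * ∫ t in Set.Icc (0 : u → ℝ) 1, |localDiscrepancy x (extendOne u t)| ^ 2 :=
  Real.sq_sqrt (Finset.sum_nonneg fun u _ =>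
    mul_nonneg (hγ u) (integral_nonneg fun _ => sq_nonneg _))

namespace IsOwenScrambling

variable {Ω : Type*} [MeasurableSpace Ω] {P : Measure Ω}
  {π : Fin s → List (Fin 2) → Ω → Equiv.Perm (Fin 2)} (hπ : IsOwenScrambling P π)
include hπ

lemma integrable_sq_weightedL2Discrepancy {γ : Finset (Fin s) → ℝ} (hγ : ∀ u, 0 ≤ γ u) :
    Integrable (fun ω =>
      weightedL2Discrepancy γ (scramblePoints (fun j a => π j a ω) x) ^ 2) P := by
  simp only [sq_weightedL2Discrepancy _ hγ]
  exact integrable_finsetSum _ fun u _ =>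
    (hπ.integrable_setIntegral_sq_localDiscrepancy x u).const_mul _

lemma integral_sq_weightedL2Discrepancy (hN : N ≠ 0) {γ : Finset (Fin s) → ℝ}
    (hγ : ∀ u, 0 ≤ γ u) :
    ∫ ω, weightedL2Discrepancy γ (scramblePoints (fun j a => π j a ω) x) ^ 2 ∂P =
      ∑ v with v.Nonempty, gammaTilde γ v * walshEnergy x v := by
  simp only [sq_weightedL2Discrepancy _ hγ]
  rw [integral_finsetSum _ fun u _ =>
    (hπ.integrable_setIntegral_sq_localDiscrepancy x u).const_mul _, sum_gammaTilde_mul]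
  simp only [integral_const_mul, hπ.integral_setIntegral_sq_localDiscrepancy hN,
    sum_nonempty_walshEnergy x hN]

end IsOwenScrambling

end WalshMeans

section Laurent

lemma toLaurent_zero : toLaurent 0 = 0 :=
  map_zero _

lemma toLaurent_add (f g : (ZMod 2)[X]) : toLaurent (f + g) = toLaurent f + toLaurent g :=
  map_add _ f g

lemma toLaurent_mul (f g : (ZMod 2)[X]) : toLaurent (f * g) = toLaurent f * toLaurent g :=
  map_mul _ f g

lemma toLaurent_sum {ι : Type*} (s : Finset ι) (f : ι → (ZMod 2)[X]) :
    toLaurent (∑ i ∈ s, f i) = ∑ i ∈ s, toLaurent (f i) :=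
  map_sum _ f s

lemma toLaurent_monomial (i : ℕ) (c : ZMod 2) :
    toLaurent (monomial i c) = HahnSeries.single (-(i : ℤ)) c := by
  have hC : algebraMap (ZMod 2) (LaurentSeries (ZMod 2)) = HahnSeries.C := RingHom.ext_zmod _ _
  rw [toLaurent, aeval_monomial, HahnSeries.single_pow, hC, HahnSeries.C_apply,
    HahnSeries.single_mul_single]
  simp

lemma coeff_toLaurent (f : (ZMod 2)[X]) (l : ℤ) :
    (toLaurent f).coeff l = if l ≤ 0 then f.coeff l.natAbs else 0 := by
  induction f using Polynomial.induction_on' with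
  | add f g hf hg =>
    rw [toLaurent_add, HahnSeries.coeff_add, hf, hg]
    split_ifs <;> simp
  | monomial i c =>
    rw [toLaurent_monomial, HahnSeries.coeff_single, coeff_monomial]
    split_ifs <;> first | rfl | lia

lemma coeff_toLaurent_neg_natDegree (f : (ZMod 2)[X]) :
    (toLaurent f).coeff (-(f.natDegree : ℤ)) = f.leadingCoeff := by
  simp [coeff_toLaurent]

lemma toLaurent_ne_zero {f : (ZMod 2)[X]} (hf : f ≠ 0) : toLaurent f ≠ 0 := fun h =>
  hf (leadingCoeff_eq_zero.1 (by rw [← coeff_toLaurent_neg_natDegree, h, HahnSeries.coeff_zero]))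

lemma order_toLaurent {f : (ZMod 2)[X]} (hf : f ≠ 0) :
    (toLaurent f).order = -(f.natDegree : ℤ) := by
  refine le_antisymm (HahnSeries.order_le_of_coeff_ne_zero ?_) ?_
  · rwa [coeff_toLaurent_neg_natDegree, leadingCoeff_ne_zero]
  · have hcoeff := HahnSeries.coeff_order_eq_zero.not.2 (toLaurent_ne_zero hf)
    rw [coeff_toLaurent, ite_eq_right_iff, Classical.not_imp] at hcoeff
    have hle := le_natDegree_of_ne_zero hcoeff.2
    lia

lemma order_toLaurent_div {f g : (ZMod 2)[X]} (hf : f ≠ 0) (hg : g ≠ 0) :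
    (toLaurent f / toLaurent g).order = g.natDegree - f.natDegree := by
  have hmul := HahnSeries.order_mul (div_ne_zero (toLaurent_ne_zero hf) (toLaurent_ne_zero hg))
    (toLaurent_ne_zero hg)
  rw [div_mul_cancel₀ _ (toLaurent_ne_zero hg), order_toLaurent hf, order_toLaurent hg] at hmul
  lia

lemma coeff_toLaurent_X_pow_mul (i : ℕ) (L : LaurentSeries (ZMod 2)) (l : ℤ) :
    (toLaurent (X ^ i) * L).coeff l = L.coeff (l + i) := by
  have hshift := HahnSeries.coeff_single_mul_add (r := (1 : ZMod 2)) (x := L) (a := l + i)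
    (b := -(i : ℤ))
  rwa [add_neg_cancel_right, one_mul, ← toLaurent_monomial, monomial_one_right_eq_X_pow] at hshift

lemma coeff_toLaurent_truncPoly_mul (m k : ℕ) (L : LaurentSeries (ZMod 2)) (l : ℤ) :
    (toLaurent (truncPoly m k) * L).coeff l =
      ∑ i ∈ Finset.range m, if k.testBit i then L.coeff (l + i) else 0 := by
  rw [truncPoly, toLaurent_sum, Finset.sum_mul, HahnSeries.coeff_sum]
  refine Finset.sum_congr rfl fun i _ => ?_
  split_ifs
  · rw [coeff_toLaurent_X_pow_mul]
  · rw [toLaurent_zero, zero_mul, HahnSeries.coeff_zero]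

/-- The coefficient of `x⁻¹` in the Laurent series of `f / p`, as an additive function of `f`. -/
def residue (p : (ZMod 2)[X]) : (ZMod 2)[X] →+ ZMod 2 where
  toFun f := (toLaurent f / toLaurent p).coeff 1
  map_zero' := by rw [toLaurent_zero, zero_div, HahnSeries.coeff_zero]
  map_add' f g := by rw [toLaurent_add, add_div, HahnSeries.coeff_add]

lemma residue_apply (p f : (ZMod 2)[X]) :
    residue p f = (toLaurent f / toLaurent p).coeff 1 :=
  rfl

lemma residue_of_dvd {p f : (ZMod 2)[X]} (hp : p ≠ 0) (h : p ∣ f) : residue p f = 0 := by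
  obtain ⟨c, rfl⟩ := h
  rw [residue_apply, toLaurent_mul, mul_div_cancel_left₀ _ (toLaurent_ne_zero hp),
    coeff_toLaurent, if_neg (by decide)]

lemma residue_mul_mod {p : (ZMod 2)[X]} (hp : p ≠ 0) (g f : (ZMod 2)[X]) :
    residue p (g * (f % p)) = residue p (g * f) := by
  have hsplit : g * f = g * (f % p) + p * (g * (f / p)) := by
    rw [mul_left_comm p, ← mul_add, EuclideanDomain.mod_add_div]
  rw [hsplit, map_add, residue_of_dvd hp (dvd_mul_right _ _), add_zero]

lemma exists_residue_X_pow_mul_ne_zero {p f : (ZMod 2)[X]} (hp : p ≠ 0) (h : ¬ p ∣ f) :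
    ∃ a < p.natDegree, residue p (X ^ a * f) ≠ 0 := by
  have hr : f % p ≠ 0 := fun hmod => h (EuclideanDomain.mod_eq_zero.1 hmod)
  have hdeg : (f % p).natDegree < p.natDegree := natDegree_lt_natDegree hr (degree_mod_lt f hp)
  refine ⟨p.natDegree - (f % p).natDegree - 1, by lia, ?_⟩
  rw [← residue_mul_mod hp, residue_apply, toLaurent_mul, mul_div_assoc,
    coeff_toLaurent_X_pow_mul]
  have hlead := HahnSeries.coeff_order_eq_zero.not.2
    (div_ne_zero (toLaurent_ne_zero hr) (toLaurent_ne_zero hp))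
  rw [order_toLaurent_div hr hp] at hlead
  convert! hlead using 2
  lia

end Laurent

section CharacterSums

lemma truncPoly_eq_of_le {k m M : ℕ} (hk : k < 2 ^ m) (hmM : m ≤ M) :
    truncPoly m k = truncPoly M k := by
  refine Finset.sum_subset (Finset.range_subset_range.2 hmM) fun i _ hi => ?_
  rw [Finset.mem_range, not_lt] at hi
  rw [Nat.testBit_lt_two_pow (hk.trans_le (Nat.pow_le_pow_right two_pos hi)),
    if_neg Bool.false_ne_true]

lemma natPoly_eq_truncPoly {m n : ℕ} (hn : n < 2 ^ m) : natPoly n = truncPoly m n :=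
  truncPoly_eq_of_le n.lt_size_self (Nat.size_le.2 hn)

lemma truncPoly_xor_two_pow {m a : ℕ} (n : ℕ) (ha : a < m) :
    truncPoly m (n ^^^ 2 ^ a) = truncPoly m n + X ^ a := by
  have hX : (X ^ a : (ZMod 2)[X]) = ∑ i ∈ Finset.range m, if i = a then X ^ i else 0 := by
    rw [Finset.sum_ite_eq' (Finset.range m) a, if_pos (Finset.mem_range.2 ha)]
  rw [hX, truncPoly, truncPoly, ← Finset.sum_add_distrib]
  refine Finset.sum_congr rfl fun i _ => ?_
  rw [Nat.testBit_xor, Nat.testBit_two_pow]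
  rcases eq_or_ne i a with rfl | hi
  · cases n.testBit i <;> simp [CharTwo.add_self_eq_zero]
  · simp [hi, hi.symm]

lemma addChar_map_sum {ι A M : Type*} [AddCommMonoid A] [CommMonoid M] (χ : AddChar A M)
    (s : Finset ι) (f : ι → A) : χ (∑ i ∈ s, f i) = ∏ i ∈ s, χ (f i) :=
  map_prod χ.toMonoidHom (fun i => Multiplicative.ofAdd (f i)) s

/-- The nontrivial additive character `c ↦ (-1)^c` of `𝔽₂`. -/
def signChar : AddChar (ZMod 2) ℝ :=
  AddChar.zmodChar 2 (ζ := -1) (by norm_num)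

lemma signChar_apply (c : ZMod 2) : signChar c = (-1) ^ c.val :=
  AddChar.zmodChar_apply _ c

lemma signChar_of_ne_zero {c : ZMod 2} (hc : c ≠ 0) : signChar c = -1 := by
  obtain rfl : c = 1 := Fin.eq_one_of_ne_zero c hc
  rw [signChar_apply, ZMod.val_one, pow_one]

lemma sum_signChar_residue_eq_zero {p f : (ZMod 2)[X]} (hp : p ≠ 0) (hf : ¬ p ∣ f) :
    ∑ n : Fin (2 ^ p.natDegree), signChar (residue p (natPoly n * f)) = 0 := by
  obtain ⟨a, ha, hres⟩ := exists_residue_X_pow_mul_ne_zero hp hf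
  let flip : Equiv.Perm (Fin (2 ^ p.natDegree)) := Function.Involutive.toPerm
    (fun n => ⟨n ^^^ 2 ^ a, Nat.xor_lt_two_pow n.2 (Nat.pow_lt_pow_right one_lt_two ha)⟩)
    fun n => by simp
  have hflip (n) : signChar (residue p (natPoly (flip n) * f)) =
      -signChar (residue p (natPoly n * f)) := by
    have hadd : natPoly (flip n) = natPoly n + X ^ a := by
      rw [natPoly_eq_truncPoly (flip n).2, natPoly_eq_truncPoly n.2]
      exact truncPoly_xor_two_pow n ha
    rw [hadd, add_mul, map_add, AddChar.map_add_eq_mul, signChar_of_ne_zero hres, mul_neg_one]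
  have hsum := Equiv.sum_comp flip fun n : Fin _ => signChar (residue p (natPoly n * f))
  simp only [hflip, Finset.sum_neg_distrib] at hsum
  linarith

end CharacterSums

section PolynomialLattice

lemma walsh_eq_prod_range {k m : ℕ} {x : ℕ → Fin 2} (hx : ∀ i ≥ m, x i = 0) :
    walsh k x = ∏ i ∈ Finset.range m, if k.testBit i then (-1) ^ (x i : ℕ) else 1 := by
  rw [← Finset.prod_filter, walsh,
    ← List.prod_toFinset _ (Nat.bitIndices_sorted (n := k)).nodup]
  refine (Finset.prod_subset (fun i hi => ?_) fun i hi hni => ?_).symm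
  · simp_all
  · rw [hx i (by simp_all), Fin.val_zero, pow_zero]

/-- The sequence of binary digits of `truncEval m L`. -/
def truncDigits (m : ℕ) (L : LaurentSeries (ZMod 2)) (i : ℕ) : Fin 2 :=
  if i < m then L.coeff (1 + i) else 0

lemma truncDigits_of_lt {m i : ℕ} (hi : i < m) (L : LaurentSeries (ZMod 2)) :
    truncDigits m L i = L.coeff (1 + i) :=
  if_pos hi

lemma truncDigits_of_le {m i : ℕ} (hi : m ≤ i) (L : LaurentSeries (ZMod 2)) :
    truncDigits m L i = 0 :=
  if_neg hi.not_gt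

lemma ofDigits_truncDigits (m : ℕ) (L : LaurentSeries (ZMod 2)) :
    Real.ofDigits (truncDigits m L) = truncEval m L := by
  rw [truncEval, ← Finset.Ico_add_one_right_eq_Icc, Finset.sum_Ico_eq_sum_range,
    Nat.add_sub_cancel, Real.ofDigits, tsum_eq_sum (s := Finset.range m) fun i hi => by
      simp [Real.ofDigitsTerm, truncDigits_of_le (by simpa using hi)]]
  refine Finset.sum_congr rfl fun i hi => ?_
  rw [Real.ofDigitsTerm, truncDigits_of_lt (Finset.mem_range.1 hi), div_eq_mul_inv, add_comm i 1]
  push_cast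
  rfl

lemma digits_truncEval (m : ℕ) (L : LaurentSeries (ZMod 2)) :
    Real.digits (truncEval m L) 2 = truncDigits m L := by
  rw [← ofDigits_truncDigits]
  exact digits_ofDigits fun n =>
    ⟨max n m, le_max_left _ _, by simp [truncDigits_of_le (le_max_right n m)]⟩

lemma walsh_digits_truncEval (m k : ℕ) (L : LaurentSeries (ZMod 2)) :
    walsh k (Real.digits (truncEval m L) 2) =
      signChar ((toLaurent (truncPoly m k) * L).coeff 1) := by
  rw [digits_truncEval, coeff_toLaurent_truncPoly_mul, addChar_map_sum,
    walsh_eq_prod_range fun i hi => truncDigits_of_le hi L]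
  refine Finset.prod_congr rfl fun i hi => ?_
  split_ifs
  · rw [truncDigits_of_lt (Finset.mem_range.1 hi), signChar_apply]
    rfl
  · rw [AddChar.map_zero_eq_one]

variable {s m : ℕ} {p : (ZMod 2)[X]} (q : Fin s → (ZMod 2)[X])

lemma prod_walsh_polyLatticePoint (n : Fin (2 ^ m)) (k : Fin s → ℕ) :
    ∏ j, walsh (k j) (Real.digits (polyLatticePoint m p q n j) 2) =
      signChar (residue p (natPoly n * ∑ j, truncPoly m (k j) * q j)) := by
  rw [Finset.mul_sum, map_sum, addChar_map_sum]
  refine Finset.prod_congr rfl fun j _ => ?_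
  rw [polyLatticePoint, walsh_digits_truncEval, ← mul_div_assoc, ← toLaurent_mul,
    mul_left_comm, residue_apply]

lemma walshMean_polyLatticePoint (hp : p ≠ 0) (hpm : p.natDegree = m) (k : Fin s → ℕ) :
    walshMean (polyLatticePoint m p q) k = (dualLattice m p q).indicator 1 k := by
  subst hpm
  simp only [walshMean, prod_walsh_polyLatticePoint]
  by_cases hk : k ∈ dualLattice p.natDegree p q
  · have hres (n : ℕ) :
        residue p (natPoly n * ∑ j, truncPoly p.natDegree (k j) * q j) = 0 :=
      residue_of_dvd hp (Dvd.dvd.mul_left hk _)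
    simp [hres, hk]
  · rw [sum_signChar_residue_eq_zero hp hk, zero_div, Set.indicator_of_notMem hk]

lemma hasSum_psiVec_dualLattice (hp : p ≠ 0) (hpm : p.natDegree = m) (v : Finset (Fin s)) :
    HasSum (fun k : {k : v → ℕ+ // extendZero v k ∈ dualLattice m p q} =>
      psiVec (extendZero v k.1)) (walshEnergy (polyLatticePoint m p q) v) := by
  have hsum := (hasSum_psiVec_mul_walshMean_sq (polyLatticePoint m p q) v).summable.hasSum
  refine (hasSum_subtype_iff_indicator (f := fun k => psiVec (extendZero v k))
    (s := {k | extendZero v k ∈ dualLattice m p q})).2 (hsum.congr_fun fun k => ?_)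
  rw [walshMean_polyLatticePoint q hp hpm]
  by_cases hk : extendZero v k ∈ dualLattice m p q <;> simp [hk]

end PolynomialLattice

end PolyLat

end

theorem mainTheorem3_general {Ω : Type*} [MeasurableSpace Ω] (P : Measure Ω) (m s : ℕ)
    (p : (ZMod 2)[X]) (hp : p ≠ 0) (hpm : p.natDegree = m) (q : Fin s → (ZMod 2)[X])
    (γ : Finset (Fin s) → ℝ) (hγ : ∀ u, 0 ≤ γ u)
    (π : Fin s → List (Fin 2) → Ω → Equiv.Perm (Fin 2))
    (hπ : PolyLat.IsOwenScrambling P π) :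
    (∀ v : Finset (Fin s), v.Nonempty →
      Summable fun k : {k : v → ℕ+ // PolyLat.extendZero v k ∈ PolyLat.dualLattice m p q} =>
        PolyLat.psiVec (PolyLat.extendZero v k.1)) ∧
    Integrable (fun ω => PolyLat.weightedL2Discrepancy γ
      (PolyLat.scramblePoints (fun j a => π j a ω) (PolyLat.polyLatticePoint m p q)) ^ 2) P ∧
    ∫ ω, PolyLat.weightedL2Discrepancy γ
        (PolyLat.scramblePoints (fun j a => π j a ω) (PolyLat.polyLatticePoint m p q)) ^ 2 ∂P =
      ∑ v : Finset (Fin s) with v.Nonempty, PolyLat.gammaTilde γ v *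
        ∑' k : {k : v → ℕ+ // PolyLat.extendZero v k ∈ PolyLat.dualLattice m p q},
          PolyLat.psiVec (PolyLat.extendZero v k.1) := by
  have hdual := PolyLat.hasSum_psiVec_dualLattice q hp hpm
  refine ⟨fun v _ => (hdual v).summable, hπ.integrable_sq_weightedL2Discrepancy _ hγ, ?_⟩
  rw [hπ.integral_sq_weightedL2Discrepancy _ (pow_ne_zero m two_ne_zero) hγ]
  simp only [(hdual _).tsum_eq]

theorem mainTheorem3 {Ω : Type*} [MeasurableSpace Ω] (P : Measure Ω) [IsProbabilityMeasure P]
    (m s : ℕ) (hm : 1 ≤ m) (hs : 1 ≤ s)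
    (p : (ZMod 2)[X]) (hp : Irreducible p) (hpm : p.natDegree = m)
    (q : Fin s → (ZMod 2)[X])
    (γ : Finset (Fin s) → ℝ) (hγ : ∀ u, 0 ≤ γ u)
    (π : Fin s → List (Fin 2) → Ω → Equiv.Perm (Fin 2))
    (hπ : PolyLat.IsOwenScrambling P π) :
    (∀ v : Finset (Fin s), v.Nonempty →
      Summable fun k : {k : v → ℕ+ // PolyLat.extendZero v k ∈ PolyLat.dualLattice m p q} =>
        PolyLat.psiVec (PolyLat.extendZero v k.1)) ∧
    Integrable (fun ω => PolyLat.weightedL2Discrepancy γ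
      (PolyLat.scramblePoints (fun j a => π j a ω) (PolyLat.polyLatticePoint m p q)) ^ 2) P ∧
    ∫ ω, PolyLat.weightedL2Discrepancy γ
        (PolyLat.scramblePoints (fun j a => π j a ω) (PolyLat.polyLatticePoint m p q)) ^ 2 ∂P =
      ∑ v : Finset (Fin s) with v.Nonempty, PolyLat.gammaTilde γ v *
        ∑' k : {k : v → ℕ+ // PolyLat.extendZero v k ∈ PolyLat.dualLattice m p q},
          PolyLat.psiVec (PolyLat.extendZero v k.1) :=
  mainTheorem3_general P m s p hp.ne_zero hpm q γ hγ π hπ
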